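/- All graphs are finite and simple, and $d(x,y)$ denotes the distance in a connected graph $G$. A set $S\subseteq V(G)$ is a resolving set of $G$ if for any two distinct vertices $x,y$ of $G$ there is $z\in S$ with $d(x,z)\neq d(y,z)$; it is a connected resolving set if moreover the subgraph induced by $S$ is connected. Let $\dim(G)$ (respectively $\operatorname{cdim}(G)$) be the minimum cardinality of a resolving set (respectively a connected resolving set) of $G$. A unicyclic graph is a connected graph with exactly one cycle. For $m\ge 3$, a generalized $m$-sun is a graph obtained from the cycle $C_m$ by attaching at most one pendant path, by one of its end vertices, to each vertex of $C_m$ (that is, an end vertex of the path is joined by an edge to the cycle vertex). Let $\mathcal U_1$ be the class of all generalized $(2k+1)$-suns, $k\ge 1$, and let $\mathcal U_2$ be the class of all generalized $2k$-suns, $k\ge 2$, such that, in each case, at least $2k-2$ consecutive vertices of the unique cycle have degree two in the graph. **Theorem.** Let $G$ be a unicyclic graph. (a) If the unique cycle of $G$ is an odd cycle, then $\operatorname{cdim}(G)=\dim(G)$ if and only if $G\in\mathcal U_1$. (b) If the unique cycle of $G$ is an even cycle, then $\operatorname{cdim}(G)=\dim(G)$ if and only if $G\in\mathcal U_2$. 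-/

import Mathlib

/-- `S` is a resolving set of `G`: any two distinct vertices are at different distances from
some vertex of `S`. -/
def SimpleGraph.IsResolving {V : Type*} (G : SimpleGraph V) (S : Finset V) : Prop :=
  ∀ x y : V, x ≠ y → ∃ z ∈ S, G.dist x z ≠ G.dist y z

/-- A connected resolving set: a resolving set inducing a connected subgraph. -/
def SimpleGraph.IsConnectedResolving {V : Type*} (G : SimpleGraph V) (S : Finset V) : Prop :=
  G.IsResolving S ∧ (G.induce (S : Set V)).Connected

/-- The metric dimension: the minimum cardinality of a resolving set. -/
noncomputable def SimpleGraph.metricDim {V : Type*} (G : SimpleGraph V) : ℕ :=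
  sInf {n | ∃ S : Finset V, G.IsResolving S ∧ S.card = n}

/-- The connected metric dimension: the minimum cardinality of a connected resolving set. -/
noncomputable def SimpleGraph.connMetricDim {V : Type*} (G : SimpleGraph V) : ℕ :=
  sInf {n | ∃ S : Finset V, G.IsConnectedResolving S ∧ S.card = n}

/-- On a finite vertex set the minimum defining the metric dimension is attained. -/
theorem SimpleGraph.exists_isResolving_card_eq_metricDim {V : Type*} [Fintype V]
    (G : SimpleGraph V) (hG : G.Connected) :
    ∃ S : Finset V, G.IsResolving S ∧ S.card = G.metricDim :=
  Nat.sInf_mem (s := {n | ∃ S : Finset V, G.IsResolving S ∧ S.card = n})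
    ⟨_, Finset.univ, fun x y hxy => ⟨x, Finset.mem_univ x, by
      rw [SimpleGraph.dist_self]
      exact (hG.pos_dist_of_ne hxy.symm).ne⟩, rfl⟩

/-- On a finite connected graph the minimum defining the connected metric dimension is
attained. -/
theorem SimpleGraph.exists_isConnectedResolving_card_eq_connMetricDim {V : Type*} [Fintype V]
    (G : SimpleGraph V) (hG : G.Connected) :
    ∃ S : Finset V, G.IsConnectedResolving S ∧ S.card = G.connMetricDim :=
  Nat.sInf_mem (s := {n | ∃ S : Finset V, G.IsConnectedResolving S ∧ S.card = n})
    ⟨_, Finset.univ, ⟨fun x y hxy => ⟨x, Finset.mem_univ x, by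
      rw [SimpleGraph.dist_self]
      exact (hG.pos_dist_of_ne hxy.symm).ne⟩, by
      rw [Finset.coe_univ]
      exact (SimpleGraph.induceUnivIso G).connected_iff.mpr hG⟩, rfl⟩

/-- A unicyclic graph: connected, with exactly one cycle (as a subgraph). -/
def SimpleGraph.IsUnicyclic {V : Type*} (G : SimpleGraph V) : Prop :=
  G.Connected ∧ ∃! C : G.Subgraph, ∃ (v : V) (c : G.Walk v v), c.IsCycle ∧ c.toSubgraph = C

/-- For `m ≥ 3`, the graph obtained from the cycle `C_m` by attaching to the cycle vertex `i`
a pendant path with `ℓ i` further vertices (no path if `ℓ i = 0`). The vertex `(i, a)`,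
`0 ≤ a ≤ ℓ i`, is the one at distance `a` from the cycle on the path attached at the cycle
vertex `i = (i, 0)`. -/
def sunGraph (m : ℕ) (ℓ : ZMod m → ℕ) :
    SimpleGraph {p : ZMod m × ℕ // p.2 ≤ ℓ p.1} :=
  SimpleGraph.fromRel fun p q =>
    (p.1.2 = 0 ∧ q.1.2 = 0 ∧ q.1.1 = p.1.1 + 1) ∨ (q.1.1 = p.1.1 ∧ q.1.2 = p.1.2 + 1)

/-- The vertex `i` of the cycle of `sunGraph m ℓ`. -/
def sunCycleVertex (m : ℕ) (ℓ : ZMod m → ℕ) (i : ZMod m) :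
    {p : ZMod m × ℕ // p.2 ≤ ℓ p.1} :=
  ⟨(i, 0), Nat.zero_le _⟩

/-- `G` is a generalized `m`-sun (`m ≥ 3`) having at least `r` consecutive vertices of degree
two on its cycle. -/
def SimpleGraph.IsSunWithDegTwoRun {V : Type*} [Fintype V] (G : SimpleGraph V)
    [DecidableRel G.Adj] (m r : ℕ) : Prop :=
  3 ≤ m ∧ ∃ (ℓ : ZMod m → ℕ) (φ : sunGraph m ℓ ≃g G) (i : ZMod m),
    ∀ j : ℕ, j < r → G.degree (φ (sunCycleVertex m ℓ (i + j))) = 2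

/-- The class `𝒰₁`: generalized `(2k+1)`-suns, `k ≥ 1`, with at least `2k-2` consecutive
cycle vertices of degree two. -/
def SimpleGraph.MemU₁ {V : Type*} [Fintype V] (G : SimpleGraph V) [DecidableRel G.Adj] : Prop :=
  ∃ k : ℕ, 1 ≤ k ∧ G.IsSunWithDegTwoRun (2 * k + 1) (2 * k - 2)

/-- The class `𝒰₂`: generalized `2k`-suns, `k ≥ 2`, with at least `2k-2` consecutive
cycle vertices of degree two. -/
def SimpleGraph.MemU₂ {V : Type*} [Fintype V] (G : SimpleGraph V) [DecidableRel G.Adj] : Prop :=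
  ∃ k : ℕ, 2 ≤ k ∧ G.IsSunWithDegTwoRun (2 * k) (2 * k - 2)

/-!
A unicyclic graph is a cycle `C_m` with a tree attached at every cycle vertex: deleting the edges
of the cycle leaves one component for each cycle vertex, because every other edge is a bridge
(`SimpleGraph.IsUnicyclic.nonempty_cyclicCoordinates`). In the coordinates `root` and `height`, the
distance between vertices of different trees is the sum of their heights and of the distance of
their roots in the cycle.

Let `S` be a connected resolving set whose size is the metric dimension. It meets two different
trees, since the two cycle neighbours of a root are equally far from all of its tree. A cut vertex
`v ∈ S` that separates two other elements of `S` would be redundant: if `x` is farther from `v`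
than `y` is, then an element of `S` separated from `x` by `v` also tells `x` and `y` apart
(`SimpleGraph.IsResolving.erase`). Hence `S` lies on the cycle, and then the trees are paths, that
is, the graph is a sun.

The metric dimension of an odd sun is 2, and that of an even sun is at most 3. If `S` has three
elements and `m = 2k`, they are consecutive, and resolving by them forces an arc without attached
paths between two vertices at distance `k - 1`. Then the end vertices of the paths at these two
vertices resolve the graph (`SimpleGraph.CyclicCoordinates.IsSun.metricDim_le_two_of_even`), which
contradicts the minimality of `S`. So `S` consists of two adjacent cycle vertices `p` and `p + 1`,
and these resolve a sun exactly if nothing is attached at the `2k - 2` cycle vertices from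
`p - k + 2` to `p + k - 1`. Conversely, such a pair is a connected resolving set of size 2, which is
a lower bound for the metric dimension.
-/

/-! ### Distances in a cycle -/

/-- The distance between two vertices of the cycle `C_m`, whose vertex set is `ZMod m`. -/
def cycDist {m : ℕ} (i j : ZMod m) : ℕ := min (i - j).val (m - (i - j).val)

theorem ZMod.exists_eq_add_natCast {m : ℕ} [NeZero m] (p i : ZMod m) :
    ∃ t < m, i = p + (t : ZMod m) :=
  ⟨(i - p).val, ZMod.val_lt _, by rw [ZMod.natCast_zmod_val]; ring⟩

theorem ZMod.add_natCast_inj {m : ℕ} (p : ZMod m) {s t : ℕ} (hs : s < m) (ht : t < m) :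
    p + (s : ZMod m) = p + (t : ZMod m) ↔ s = t := by
  refine ⟨fun h => ?_, fun h => h ▸ rfl⟩
  rw [← ZMod.val_natCast_of_lt hs, ← ZMod.val_natCast_of_lt ht, add_left_cancel h]

theorem cycDist_add_natCast {m : ℕ} [NeZero m] (p : ZMod m) {s t : ℕ} (hs : s < m) (ht : t < m) :
    cycDist (p + (s : ZMod m)) (p + (t : ZMod m)) =
      min (max s t - min s t) (m - (max s t - min s t)) := by
  unfold cycDist
  rcases le_total t s with h | h
  · have e : p + (s : ZMod m) - (p + (t : ZMod m)) = ((s - t : ℕ) : ZMod m) := by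
      rw [Nat.cast_sub h]; ring
    rw [e, ZMod.val_natCast_of_lt (by omega), max_eq_left h, min_eq_right h]
  · rcases h.eq_or_lt with rfl | h'
    · simp
    · have e : p + (s : ZMod m) - (p + (t : ZMod m)) = ((m + s - t : ℕ) : ZMod m) := by
        rw [Nat.cast_sub (by omega)]; push_cast; rw [ZMod.natCast_self]; ring
      rw [e, ZMod.val_natCast_of_lt (by omega), max_eq_right h, min_eq_left h]
      omega

theorem ZMod.add_natCast_add_one {m : ℕ} [NeZero m] (p : ZMod m) {t : ℕ} (ht : t < m) :
    ∃ s < m, p + (t : ZMod m) + 1 = p + (s : ZMod m) ∧ (s = t + 1 ∨ t + 1 = m ∧ s = 0) := by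
  rcases Nat.lt_or_ge (t + 1) m with h | h
  · exact ⟨t + 1, h, by push_cast; ring, Or.inl rfl⟩
  · refine ⟨0, by omega, ?_, Or.inr ⟨by omega, rfl⟩⟩
    have e : ((t + 1 : ℕ) : ZMod m) = 0 := by
      rw [show t + 1 = m by omega, ZMod.natCast_self]
    push_cast at e
    rw [add_assoc, e, Nat.cast_zero]

theorem cycDist_self {m : ℕ} (i : ZMod m) : cycDist i i = 0 := by simp [cycDist]

theorem cycDist_comm {m : ℕ} [NeZero m] (i j : ZMod m) : cycDist i j = cycDist j i := by
  obtain ⟨t, ht, rfl⟩ := ZMod.exists_eq_add_natCast j i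
  have e := cycDist_add_natCast j ht (NeZero.pos m)
  have e' := cycDist_add_natCast j (NeZero.pos m) ht
  rw [Nat.cast_zero, add_zero] at e e'
  omega

theorem cycDist_add_one_le {m : ℕ} [NeZero m] (i j : ZMod m) :
    cycDist (i + 1) j ≤ cycDist i j + 1 ∧ cycDist i j ≤ cycDist (i + 1) j + 1 := by
  obtain ⟨t, ht, rfl⟩ := ZMod.exists_eq_add_natCast j i
  obtain ⟨s, hs, e, hst⟩ := ZMod.add_natCast_add_one j ht
  have e1 := cycDist_add_natCast j ht (NeZero.pos m)
  have e2 := cycDist_add_natCast j hs (NeZero.pos m)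
  rw [Nat.cast_zero, add_zero] at e1 e2
  rw [e]
  omega

theorem exists_cycDist_add_one_eq {m : ℕ} [NeZero m] {i j : ZMod m} (h : i ≠ j) :
    cycDist (i + 1) j + 1 = cycDist i j ∨ cycDist (i - 1) j + 1 = cycDist i j := by
  obtain ⟨t, ht, rfl⟩ := ZMod.exists_eq_add_natCast j i
  obtain ⟨s, hs, e, hst⟩ := ZMod.add_natCast_add_one j ht
  have ht0 : t ≠ 0 := by rintro rfl; simp at h
  have e1 := cycDist_add_natCast j ht (NeZero.pos m)
  have e2 := cycDist_add_natCast j hs (NeZero.pos m)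
  have e3 := cycDist_add_natCast j (show t - 1 < m by omega) (NeZero.pos m)
  have e' : j + (t : ZMod m) - 1 = j + ((t - 1 : ℕ) : ZMod m) := by
    rw [Nat.cast_sub (by omega)]; push_cast; ring
  rw [Nat.cast_zero, add_zero] at e1 e2 e3
  rw [e, e']
  omega

theorem cycDist_add_one_self {m : ℕ} (hm : 3 ≤ m) (i : ZMod m) :
    cycDist (i + 1) i = 1 ∧ cycDist (i - 1) i = 1 := by
  have : NeZero m := ⟨by omega⟩
  have e2 := cycDist_add_natCast i (show 1 < m by omega) (NeZero.pos m)
  have e3 := cycDist_add_natCast (i - 1) (NeZero.pos m) (show 1 < m by omega)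
  rw [Nat.cast_zero, add_zero, Nat.cast_one] at e2 e3
  rw [sub_add_cancel] at e3
  omega

theorem ZMod.add_one_ne_sub_one {m : ℕ} (hm : 3 ≤ m) (i : ZMod m) : i + 1 ≠ i - 1 := by
  intro h
  have e := ZMod.add_natCast_inj (i - 1) (show 2 < m by omega) (show 0 < m by omega)
  push_cast at e
  rw [add_zero, show i - 1 + 2 = i + 1 by ring] at e
  exact absurd (e.1 h) (by norm_num)

/-! ### Bounding distances by potential functions -/

namespace SimpleGraph

variable {V : Type*} {G : SimpleGraph V}

theorem Connected.le_add_dist (hG : G.Connected) {f : V → ℕ}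
    (hf : ∀ x y, G.Adj x y → f x ≤ f y + 1) (x z : V) : f x ≤ f z + G.dist x z := by
  obtain ⟨w, hw⟩ := hG.exists_walk_length_eq_dist x z
  rw [← hw]
  clear hw
  induction w with
  | nil => simp
  | cons h w ih =>
    have := hf _ _ h
    rw [Walk.length_cons]
    omega

theorem Connected.dist_le_of_descent (hG : G.Connected) {f : V → ℕ} {z : V}
    (hf : ∀ x, x ≠ z → ∃ y, G.Adj x y ∧ f y + 1 = f x) (x : V) : G.dist x z ≤ f x := by
  induction h : f x using Nat.strong_induction_on generalizing x with
  | _ n ih =>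
    rcases eq_or_ne x z with rfl | hx
    · simp
    · obtain ⟨y, hxy, hy⟩ := hf x hx
      have h1 := ih (f y) (by omega) y rfl
      have h2 := hG.dist_triangle (u := x) (v := y) (w := z)
      rw [dist_eq_one_iff_adj.2 hxy] at h2
      omega

/-! ### A cycle with rooted graphs attached -/

/-- A presentation of `G` as the cycle `C_m` with a rooted graph attached at every cycle vertex:
`cyc i` is the vertex `i` of the cycle, `root x` is the cycle vertex at which `x` is attached, and
`height x` is the distance of `x` from the cycle. That the attached graphs are trees is not part
of the structure. -/
structure CyclicCoordinates (G : SimpleGraph V) (m : ℕ) where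
  three_le : 3 ≤ m
  root : V → ZMod m
  height : V → ℕ
  cyc : ZMod m → V
  root_cyc : ∀ i, root (cyc i) = i
  height_cyc : ∀ i, height (cyc i) = 0
  cyc_root : ∀ x, height x = 0 → cyc (root x) = x
  adj_cyc : ∀ i, G.Adj (cyc i) (cyc (i + 1))
  adj_cases : ∀ x y, G.Adj x y → (root x = root y ∧ height x ≤ height y + 1) ∨
    (height x = 0 ∧ height y = 0 ∧ (root y = root x + 1 ∨ root x = root y + 1))
  descend : ∀ x, height x ≠ 0 → ∃ y, G.Adj x y ∧ root y = root x ∧ height y + 1 = height x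

namespace CyclicCoordinates

variable {m : ℕ} (D : G.CyclicCoordinates m)

theorem cyc_injective : Function.Injective D.cyc := fun i j h => by
  rw [← D.root_cyc i, h, D.root_cyc]

theorem height_le (x y : V) (h : G.Adj x y) : D.height x ≤ D.height y + 1 := by
  rcases D.adj_cases x y h with h | h <;> omega

theorem dist_cyc [NeZero m] (hG : G.Connected) (x : V) (i : ZMod m) :
    G.dist x (D.cyc i) = D.height x + cycDist (D.root x) i := by
  apply le_antisymm
  · apply hG.dist_le_of_descent (f := fun x => D.height x + cycDist (D.root x) i)
    intro x hx
    by_cases h0 : D.height x = 0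
    · have hxr := D.cyc_root x h0
      have hne : D.root x ≠ i := by rintro rfl; exact hx hxr.symm
      rcases exists_cycDist_add_one_eq hne with h | h
      · refine ⟨D.cyc (D.root x + 1), ?_, ?_⟩
        · conv_lhs => rw [← hxr]
          exact D.adj_cyc _
        · simp only [D.height_cyc, D.root_cyc]; omega
      · refine ⟨D.cyc (D.root x - 1), ?_, ?_⟩
        · conv_lhs => rw [← hxr]
          have := D.adj_cyc (D.root x - 1)
          rw [sub_add_cancel] at this
          exact this.symm
        · simp only [D.height_cyc, D.root_cyc]; omega
    · obtain ⟨y, hxy, hr, hh⟩ := D.descend x h0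
      exact ⟨y, hxy, by simp only [hr]; omega⟩
  · have := hG.le_add_dist (f := fun x => D.height x + cycDist (D.root x) i) (fun x y h => by
      rcases D.adj_cases x y h with ⟨h1, h2⟩ | ⟨h1, h2, h3⟩
      · simp only [h1]; omega
      · have a := cycDist_add_one_le (D.root x) i
        have b := cycDist_add_one_le (D.root y) i
        rcases h3 with h3 | h3
        · simp only [h3]; omega
        · simp only [h3]; omega) x (D.cyc i)
    simpa [D.height_cyc, D.root_cyc, cycDist_self] using this

/-- The distance formula holds because every walk between two different attached graphs passes
through their roots. -/
theorem dist_of_root_ne [NeZero m] (hG : G.Connected) {x z : V} (h : D.root x ≠ D.root z) :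
    G.dist x z = D.height x + cycDist (D.root x) (D.root z) + D.height z := by
  classical
  have hz : G.dist (D.cyc (D.root z)) z = D.height z := by
    rw [dist_comm, D.dist_cyc hG, cycDist_self, add_zero]
  apply le_antisymm
  · have h1 := hG.dist_triangle (u := x) (v := D.cyc (D.root z)) (w := z)
    rw [D.dist_cyc hG, hz] at h1
    exact h1
  · have key := hG.le_add_dist (f := fun y => if D.root y = D.root z then G.dist y z else
      D.height y + cycDist (D.root y) (D.root z) + D.height z) (fun a b hab => by
        rcases D.adj_cases a b hab with ⟨h1, h2⟩ | ⟨h1, h2, h3⟩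
        · simp only [h1]
          split_ifs
          · have := hG.dist_triangle (u := a) (v := b) (w := z)
            rw [dist_eq_one_iff_adj.2 hab] at this
            omega
          · omega
        · have hc : cycDist (D.root a) (D.root z) ≤ cycDist (D.root b) (D.root z) + 1 := by
            have h4 := cycDist_add_one_le (D.root a) (D.root z)
            have h5 := cycDist_add_one_le (D.root b) (D.root z)
            rcases h3 with h3 | h3
            · rw [← h3] at h4; omega
            · rw [← h3] at h5; omega
          have ha := D.cyc_root a h1
          have hb := D.cyc_root b h2
          have ea : D.root a = D.root z → G.dist a z = D.height z := fun e => by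
            rw [← ha, e, hz]
          have eb : D.root b = D.root z → G.dist b z = D.height z := fun e => by
            rw [← hb, e, hz]
          have ca : D.root a = D.root z → cycDist (D.root a) (D.root z) = 0 := fun e => by
            rw [e, cycDist_self]
          have cb : D.root b = D.root z → cycDist (D.root b) (D.root z) = 0 := fun e => by
            rw [e, cycDist_self]
          split_ifs with i1 i2 i2
          · rw [ea i1, eb i2]; omega
          · rw [ea i1]; omega
          · rw [eb i2]; rw [cb i2] at hc; omega
          · omega) x z
    simpa [h] using key

/-- The two cycle neighbours of `i` are at equal distances from every vertex attached at `i`,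
so no resolving set lies in a single attached graph. -/
theorem exists_mem_root_ne [NeZero m] (hG : G.Connected) {S : Finset V} (hS : G.IsResolving S)
    (i : ZMod m) : ∃ z ∈ S, D.root z ≠ i := by
  by_contra! h
  obtain ⟨z, hz, hne⟩ := hS (D.cyc (i + 1)) (D.cyc (i - 1))
    (fun e => ZMod.add_one_ne_sub_one D.three_le i (D.cyc_injective e))
  have hi := h z hz
  have hc := cycDist_add_one_self D.three_le i
  have hp : i + 1 ≠ i := fun e => by have := hc.1; rw [e, cycDist_self] at this; omega
  have hm : i - 1 ≠ i := fun e => by have := hc.2; rw [e, cycDist_self] at this; omega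
  apply hne
  rw [D.dist_of_root_ne hG (by rw [D.root_cyc, hi]; exact hp),
    D.dist_of_root_ne hG (by rw [D.root_cyc, hi]; exact hm)]
  simp only [D.root_cyc, D.height_cyc, hi, hc]

theorem two_le_card [NeZero m] (D : G.CyclicCoordinates m) (hG : G.Connected) {S : Finset V}
    (hS : G.IsResolving S) :
    2 ≤ S.card := by
  obtain ⟨z, hz, -⟩ := D.exists_mem_root_ne hG hS 0
  obtain ⟨w, hw, hne⟩ := D.exists_mem_root_ne hG hS (D.root z)
  exact Finset.one_lt_card.2 ⟨z, hz, w, hw, fun e => hne (e ▸ rfl)⟩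

end CyclicCoordinates

/-! ### Connected resolving sets -/

theorem IsResolving.metricDim_le {S : Finset V} (hS : G.IsResolving S) : G.metricDim ≤ S.card :=
  Nat.sInf_le ⟨S, hS, rfl⟩

theorem IsConnectedResolving.connMetricDim_le {S : Finset V} (hS : G.IsConnectedResolving S) :
    G.connMetricDim ≤ S.card :=
  Nat.sInf_le ⟨S, hS, rfl⟩

theorem Connected.metricDim_le_connMetricDim [Fintype V] (hG : G.Connected) :
    G.metricDim ≤ G.connMetricDim := by
  obtain ⟨S, hS, hc⟩ := G.exists_isConnectedResolving_card_eq_connMetricDim hG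
  exact hc ▸ hS.1.metricDim_le

/-- A vertex `v` such that from every vertex some shortest path runs through `v` to another
element of `S` is redundant in the resolving set `S`. -/
theorem IsResolving.erase [DecidableEq V] (hG : G.Connected) {S : Finset V} (hS : G.IsResolving S)
    {v : V} (hv : ∀ x, x ≠ v → ∃ z ∈ S.erase v, G.dist x z = G.dist x v + G.dist v z) :
    G.IsResolving (S.erase v) := by
  have key : ∀ x y, G.dist y v < G.dist x v → ∃ z ∈ S.erase v, G.dist x z ≠ G.dist y z := by
    intro x y h
    obtain ⟨z, hz, e⟩ := hv x (by rintro rfl; simp at h)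
    refine ⟨z, hz, ?_⟩
    have := hG.dist_triangle (u := y) (v := v) (w := z)
    omega
  intro x y hxy
  obtain ⟨z, hz, hne⟩ := hS x y hxy
  rcases eq_or_ne z v with rfl | hzv
  · rcases lt_or_gt_of_ne hne with h | h
    · obtain ⟨w, hw, hne⟩ := key y x h
      exact ⟨w, hw, hne.symm⟩
    · exact key x y h
  · exact ⟨z, Finset.mem_erase.2 ⟨hzv, hz⟩, hne⟩

/-- A connected vertex set meeting both a set and its complement has an edge between the two. -/
theorem exists_adj_of_induce_connected {S : Finset V} (hS : (G.induce (S : Set V)).Connected)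
    (P : V → Prop) {u w : V} (hu : u ∈ S) (hw : w ∈ S) (hPu : P u) (hPw : ¬ P w) :
    ∃ x ∈ S, ∃ y ∈ S, G.Adj x y ∧ P x ∧ ¬ P y := by
  by_contra! h
  obtain ⟨p⟩ := hS.preconnected ⟨u, hu⟩ ⟨w, hw⟩
  have : ∀ a b : (S : Set V), (G.induce (S : Set V)).Walk a b → P a → P b := by
    intro a b p
    induction p with
    | nil => exact id
    | cons hab _ ih => exact fun ha => ih (h _ (Subtype.prop _) _ (Subtype.prop _) hab ha)
  exact hPw (this _ _ p hPu)

namespace CyclicCoordinates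

variable {m : ℕ} (D : G.CyclicCoordinates m)

/-- If a connected resolving set is a smallest resolving set, it lies on the cycle: otherwise it
contains both a vertex attached at a cycle vertex `v` and `v` itself, and `v` is redundant. -/
theorem height_eq_zero_of_mem [NeZero m] (hG : G.Connected) {S : Finset V}
    (hS : G.IsConnectedResolving S) (hcard : S.card = G.metricDim) {u : V} (hu : u ∈ S) :
    D.height u = 0 := by
  classical
  by_contra h0
  obtain ⟨w, hw, hwr⟩ := D.exists_mem_root_ne hG hS.1 (D.root u)
  obtain ⟨x, hx, y, hy, hxy, hxr, hyr⟩ :=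
    exists_adj_of_induce_connected hS.2 (fun x => D.root x = D.root u) hu hw rfl hwr
  set v := D.cyc (D.root u) with hv
  have hvS : v ∈ S := by
    rcases D.adj_cases x y hxy with h | h
    · exact absurd (h.1.symm.trans hxr) hyr
    · rw [hv, ← hxr, D.cyc_root x h.1]; exact hx
  have huv : u ≠ v := fun e => h0 (by rw [e, hv, D.height_cyc])
  have hwv : w ≠ v := fun e => hwr (by rw [e, hv, D.root_cyc])
  have hres : G.IsResolving (S.erase v) := by
    refine hS.1.erase hG fun x _ => ?_
    by_cases hxu : D.root x = D.root u
    · refine ⟨w, Finset.mem_erase.2 ⟨hwv, hw⟩, ?_⟩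
      rw [D.dist_of_root_ne hG (by rw [hxu]; exact hwr.symm), dist_comm (u := v), hv,
        D.dist_cyc hG, D.dist_cyc hG, hxu, cycDist_self, cycDist_comm (D.root w)]
      omega
    · refine ⟨u, Finset.mem_erase.2 ⟨huv, hu⟩, ?_⟩
      rw [D.dist_of_root_ne hG hxu, dist_comm (u := v), hv,
        D.dist_cyc hG, D.dist_cyc hG, cycDist_self]
      omega
  have := hres.metricDim_le
  rw [Finset.card_erase_of_mem hvS] at this
  have := Finset.card_pos.2 ⟨v, hvS⟩
  omega

/-- If a subset of the cycle resolves `G`, the graphs attached to the cycle are paths: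
two vertices with equal root and height are equally far from every cycle vertex. -/
theorem ext_of_isResolving [NeZero m] (hG : G.Connected) {S : Finset V} (hS : G.IsResolving S)
    (h0 : ∀ u ∈ S, D.height u = 0) (x y : V) (hr : D.root x = D.root y)
    (hh : D.height x = D.height y) : x = y := by
  by_contra hne
  obtain ⟨z, hz, h⟩ := hS x y hne
  apply h
  rw [← D.cyc_root z (h0 z hz), D.dist_cyc hG, D.dist_cyc hG, hr, hh]

/-! ### Metric dimension of suns -/

/-- Every attached graph is a path, attached at an end vertex: a vertex is determined by its root
and its height. -/
def IsSun : Prop := ∀ x y, D.root x = D.root y → D.height x = D.height y → x = y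

theorem exists_height_eq (x : V) {n : ℕ} (hn : n ≤ D.height x) :
    ∃ y, D.root y = D.root x ∧ D.height y = n := by
  induction h : D.height x - n generalizing x with
  | zero => exact ⟨x, rfl, by omega⟩
  | succ j ih =>
    obtain ⟨y, -, hr, hh⟩ := D.descend x (by omega)
    obtain ⟨z, hz, hz'⟩ := ih y (by omega) (by omega)
    exact ⟨z, hz.trans hr, hz'⟩

theorem exists_leaf [Finite V] (i : ZMod m) :
    ∃ z, D.root z = i ∧ ∀ x, D.root x = i → D.height x ≤ D.height z := by
  obtain ⟨z, hz, h⟩ := Set.exists_max_image {x | D.root x = i} D.height (Set.toFinite _)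
    ⟨D.cyc i, D.root_cyc i⟩
  exact ⟨z, hz, h⟩

variable {D}

theorem IsSun.dist_of_root_eq (hD : D.IsSun) (hG : G.Connected) {x z : V}
    (hr : D.root x = D.root z) (hh : D.height x ≤ D.height z) :
    D.height x + G.dist x z = D.height z := by
  apply le_antisymm
  · induction h : D.height z - D.height x generalizing z with
    | zero => rw [hD x z hr (by omega), dist_self, add_zero]
    | succ j ih =>
      obtain ⟨y, hzy, hyr, hyh⟩ := D.descend z (by omega)
      have h1 := ih (hr.trans hyr.symm) (by omega) (by omega)
      have h2 := hG.dist_triangle (u := x) (v := y) (w := z)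
      rw [dist_eq_one_iff_adj.2 hzy.symm] at h2
      omega
  · have := hG.le_add_dist D.height_le z x
    rwa [dist_comm] at this

/-- In an odd sun, two cycle vertices at the largest possible distance form a resolving set: the
difference of the distances to them determines the root, since it takes different parities on the
two arcs. -/
theorem IsSun.metricDim_le_two_of_odd (hD : D.IsSun) (hG : G.Connected) {k : ℕ}
    (hm : m = 2 * k + 1) : G.metricDim ≤ 2 := by
  classical
  have h3 := D.three_le
  have : NeZero m := ⟨by omega⟩
  suffices h : G.IsResolving
      {D.cyc (0 + ((0 : ℕ) : ZMod m)), D.cyc (0 + ((k : ℕ) : ZMod m))} from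
    h.metricDim_le.trans Finset.card_le_two
  have arc : ∀ t < m,
      (t ≤ k ∧ cycDist (0 + (t : ZMod m)) (0 + ((0 : ℕ) : ZMod m)) = t ∧
        cycDist (0 + (t : ZMod m)) (0 + (k : ZMod m)) = k - t) ∨
      (k < t ∧ cycDist (0 + (t : ZMod m)) (0 + ((0 : ℕ) : ZMod m)) = m - t ∧
        cycDist (0 + (t : ZMod m)) (0 + (k : ZMod m)) = t - k) := by
    intro t ht
    rw [cycDist_add_natCast 0 ht (by omega), cycDist_add_natCast 0 ht (by omega)]
    omega
  intro x y hxy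
  by_contra! h
  have h0 := h _ (Finset.mem_insert_self _ _)
  have hk := h _ (Finset.mem_insert_of_mem (Finset.mem_singleton_self _))
  obtain ⟨t, ht, et⟩ := ZMod.exists_eq_add_natCast 0 (D.root x)
  obtain ⟨s, hs, es⟩ := ZMod.exists_eq_add_natCast 0 (D.root y)
  simp only [D.dist_cyc hG, et, es] at h0 hk
  have key : s = t ∧ D.height x = D.height y := by
    rcases arc t ht with ⟨_, a, b⟩ | ⟨_, a, b⟩ <;> rcases arc s hs with ⟨_, c, d⟩ | ⟨_, c, d⟩ <;>
      rw [a, c] at h0 <;> rw [b, d] at hk <;> omega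
  obtain ⟨rfl, hh⟩ := key
  exact hxy (hD x y (et.trans es.symm) hh)

/-- An even sun is resolved by two adjacent cycle vertices, which tell apart the two arcs between
one of them and its antipode, together with that antipode. -/
theorem IsSun.metricDim_le_three_of_even (hD : D.IsSun) (hG : G.Connected) {k : ℕ}
    (hm : m = 2 * k) : G.metricDim ≤ 3 := by
  classical
  have h3 := D.three_le
  have : NeZero m := ⟨by omega⟩
  suffices h : G.IsResolving {D.cyc (0 + ((0 : ℕ) : ZMod m)), D.cyc (0 + ((1 : ℕ) : ZMod m)),
      D.cyc (0 + ((k : ℕ) : ZMod m))} from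
    h.metricDim_le.trans Finset.card_le_three
  have arc : ∀ t < m, ∃ d0 d1 dk, cycDist (0 + (t : ZMod m)) (0 + ((0 : ℕ) : ZMod m)) = d0 ∧
      cycDist (0 + (t : ZMod m)) (0 + ((1 : ℕ) : ZMod m)) = d1 ∧
      cycDist (0 + (t : ZMod m)) (0 + (k : ZMod m)) = dk ∧
      ((t = 0 ∧ d0 = 0 ∧ d1 = 1 ∧ dk = k) ∨
        (1 ≤ t ∧ d0 = t ∧ t = d1 + 1 ∧ t + dk = k) ∨
        (k < t ∧ d0 + t = 2 * k ∧ d1 = d0 + 1 ∧ t = dk + k)) := by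
    intro t ht
    refine ⟨_, _, _, cycDist_add_natCast 0 ht (by omega), cycDist_add_natCast 0 ht (by omega),
      cycDist_add_natCast 0 ht (by omega), ?_⟩
    rcases Nat.eq_zero_or_pos t with h | h
    · left; omega
    · rcases Nat.lt_or_ge k t with h' | h'
      · right; right; omega
      · right; left; omega
  intro x y hxy
  by_contra! h
  have h0 := h (D.cyc (0 + ((0 : ℕ) : ZMod m))) (by simp)
  have h1 := h (D.cyc (0 + ((1 : ℕ) : ZMod m))) (by simp)
  have hk := h (D.cyc (0 + ((k : ℕ) : ZMod m))) (by simp)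
  obtain ⟨t, ht, et⟩ := ZMod.exists_eq_add_natCast 0 (D.root x)
  obtain ⟨s, hs, es⟩ := ZMod.exists_eq_add_natCast 0 (D.root y)
  simp only [D.dist_cyc hG, et, es] at h0 h1 hk
  have key : s = t ∧ D.height x = D.height y := by
    obtain ⟨_, _, _, a0, a1, ak, a⟩ := arc t ht
    obtain ⟨_, _, _, b0, b1, bk, b⟩ := arc s hs
    rw [a0, b0] at h0
    rw [a1, b1] at h1
    rw [ak, bk] at hk
    rcases a with a | a | a <;> rcases b with b | b | b <;> omega
  obtain ⟨rfl, hh⟩ := key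
  exact hxy (hD x y (et.trans es.symm) hh)

/-- In an even sun with cycle length `2k`, let `p` and `q` be cycle vertices at distance `k - 1`
such that no path is attached strictly between them on the short arc. The end vertices of the
paths at `p` and `q` form a resolving set. -/
theorem IsSun.metricDim_le_two_of_even [Finite V] (hD : D.IsSun) (hG : G.Connected) {k : ℕ}
    (hm : m = 2 * k) (p : ZMod m)
    (hp : ∀ t : ℕ, 1 ≤ t → t + 2 ≤ k → ∀ x, D.root x = p + (t : ZMod m) → D.height x ≠ 1) :
    G.metricDim ≤ 2 := by
  classical
  have h3 := D.three_le
  have : NeZero m := ⟨by omega⟩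
  obtain ⟨z, hz, hzmax⟩ := D.exists_leaf (p + ((0 : ℕ) : ZMod m))
  obtain ⟨w, hw, hwmax⟩ := D.exists_leaf (p + ((k - 1 : ℕ) : ZMod m))
  have far : ∀ (u : V) (c : ℕ), c < m → D.root u = p + (c : ZMod m) →
      ∀ x t, t < m → D.root x = p + (t : ZMod m) → t ≠ c → G.dist x u =
        D.height x + min (max t c - min t c) (m - (max t c - min t c)) + D.height u := by
    intro u c hc hu x t ht hx htc
    rw [D.dist_of_root_ne hG, hx, hu, cycDist_add_natCast p ht hc]
    rw [hx, hu]
    exact fun e => htc ((ZMod.add_natCast_inj p ht hc).1 e)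
  have loc : ∀ x t, t < m → D.root x = p + (t : ZMod m) →
      (t = 0 ∧ D.height x + G.dist x z = D.height z ∧
        G.dist x w = D.height x + (k - 1) + D.height w) ∨
      (1 ≤ t ∧ t + 2 ≤ k ∧ D.height x = 0 ∧ G.dist x z = t + D.height z ∧
        G.dist x w + t = k - 1 + D.height w) ∨
      (t = k - 1 ∧ G.dist x z = D.height x + (k - 1) + D.height z ∧
        D.height x + G.dist x w = D.height w) ∨
      (k ≤ t ∧ G.dist x z + t = D.height x + 2 * k + D.height z ∧
        G.dist x w + k = D.height x + t + 1 + D.height w) := by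
    intro x t ht hx
    have fz := far z 0 (by omega) hz x t ht hx
    have fw := far w (k - 1) (by omega) hw x t ht hx
    rcases Nat.eq_zero_or_pos t with rfl | h0
    · left
      refine ⟨rfl, hD.dist_of_root_eq hG (hx.trans hz.symm) (hzmax x hx), ?_⟩
      have := fw (by omega)
      omega
    · have fz := fz (by omega)
      rcases lt_trichotomy t (k - 1) with h | rfl | h
      · have fw := fw (by omega)
        have hx0 : D.height x = 0 := by
          by_contra hx0
          obtain ⟨y, hy, hy1⟩ := D.exists_height_eq x (n := 1) (by omega)
          exact hp t h0 (by omega) y (hy.trans hx) hy1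
        right; left
        rw [hx0] at fz fw ⊢
        refine ⟨h0, by omega, rfl, by omega, by omega⟩
      · right; right; left
        exact ⟨rfl, by omega, hD.dist_of_root_eq hG (hx.trans hw.symm) (hwmax x hx)⟩
      · have fw := fw (by omega)
        right; right; right
        exact ⟨by omega, by omega, by omega⟩
  suffices h : G.IsResolving {z, w} from h.metricDim_le.trans Finset.card_le_two
  intro x y hxy
  by_contra! h
  have h0 := h z (by simp)
  have h1 := h w (by simp)
  obtain ⟨t, ht, et⟩ := ZMod.exists_eq_add_natCast p (D.root x)
  obtain ⟨s, hs, es⟩ := ZMod.exists_eq_add_natCast p (D.root y)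
  have key : s = t ∧ D.height x = D.height y := by
    rcases loc x t ht et with a | a | a | a <;> rcases loc y s hs es with b | b | b | b <;> omega
  obtain ⟨rfl, hh⟩ := key
  exact hxy (hD x y (et.trans es.symm) hh)

/-! ### Resolving sets of consecutive cycle vertices -/

/-- Two adjacent cycle vertices `p`, `p + 1` resolve a sun if paths are attached only at the cycle
vertices `p + t` with `k ≤ t ≤ m + 1 - k`, which are those farthest from `p` and `p + 1`. For
`k = 1`, that is, on a triangle, there is no condition. -/
theorem IsSun.isResolving_pair [DecidableEq V] (hD : D.IsSun) (hG : G.Connected) {k : ℕ}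
    (hm : m = 2 * k ∨ m = 2 * k + 1) (p : ZMod m)
    (hp : ∀ t : ℕ, t < m → 2 ≤ k → t < k ∨ m + 2 ≤ t + k →
      ∀ x, D.root x = p + (t : ZMod m) → D.height x = 0) :
    G.IsResolving {D.cyc p, D.cyc (p + 1)} := by
  have h3 := D.three_le
  have : NeZero m := ⟨by omega⟩
  have loc : ∀ x t, t < m → D.root x = p + (t : ZMod m) → ∃ d0 d1,
      G.dist x (D.cyc (p + ((0 : ℕ) : ZMod m))) = d0 ∧
      G.dist x (D.cyc (p + ((1 : ℕ) : ZMod m))) = d1 ∧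
      ((t < k ∧ 2 ≤ k ∧ 1 ≤ t ∧ D.height x = 0 ∧ d0 = t ∧ d0 = d1 + 1) ∨
      (t = k ∧ d0 = D.height x + k ∧ d0 = d1 + 1) ∨
      (t = k + 1 ∧ m = 2 * k + 1 ∧ d0 = D.height x + k ∧ d0 = d1) ∨
      (t = 0 ∧ k = 1 ∧ d0 = D.height x ∧ d1 = d0 + 1) ∨
      (t = 0 ∧ 2 ≤ k ∧ D.height x = 0 ∧ d0 = 0 ∧ d1 = d0 + 1) ∨
      (k + 1 ≤ t ∧ t + k = m + 1 ∧ d0 = D.height x + (k - 1) ∧ d1 = d0 + 1) ∨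
      (m + 2 ≤ t + k ∧ D.height x = 0 ∧ d0 + t = m ∧ d1 = d0 + 1)) := by
    intro x t ht hx
    refine ⟨_, _, D.dist_cyc hG _ _, D.dist_cyc hG _ _, ?_⟩
    rw [hx, cycDist_add_natCast p ht (by omega), cycDist_add_natCast p ht (by omega)]
    have hx0 := fun h2 h3 => hp t ht h2 h3 x hx
    clear hp hx
    generalize D.height x = a at *
    rcases Nat.eq_zero_or_pos t with h0 | h0
    · by_cases hk : 2 ≤ k
      · have := hx0 hk (by omega)
        right; right; right; right; left; omega
      · right; right; right; left; omega
    · rcases lt_trichotomy t k with h | h | h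
      · have := hx0 (by omega) (by omega)
        left; omega
      · right; left; omega
      · by_cases h' : m + 2 ≤ t + k
        · have := hx0 (by omega) (by omega)
          right; right; right; right; right; right; omega
        · by_cases h'' : t + k = m + 1
          · right; right; right; right; right; left; omega
          · right; right; left; omega
  intro x y hxy
  by_contra! h
  have h0 := h (D.cyc (p + ((0 : ℕ) : ZMod m))) (by simp)
  have h1 := h (D.cyc (p + ((1 : ℕ) : ZMod m))) (by simp)
  obtain ⟨t, ht, et⟩ := ZMod.exists_eq_add_natCast p (D.root x)
  obtain ⟨s, hs, es⟩ := ZMod.exists_eq_add_natCast p (D.root y)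
  have key : s = t ∧ D.height x = D.height y := by
    obtain ⟨_, _, a0, a1, a⟩ := loc x t ht et
    obtain ⟨_, _, b0, b1, b⟩ := loc y s hs es
    rw [a0, b0] at h0
    rw [a1, b1] at h1
    clear hp loc h a0 a1 b0 b1
    rcases a with a | a | a | a | a | a | a <;> omega
  obtain ⟨rfl, hh⟩ := key
  exact hxy (hD x y (et.trans es.symm) hh)

variable (D)

/-- The converse of `IsSun.isResolving_pair`: a neighbour off the cycle of one of the other cycle
vertices has the same distances to `p` and `p + 1` as the next cycle vertex away from them. -/
theorem height_ne_one_of_isResolving_pair (hG : G.Connected) {k : ℕ}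
    (hm : m = 2 * k ∨ m = 2 * k + 1) (p : ZMod m) {S : Finset V} (hS : G.IsResolving S)
    (hSp : ∀ z ∈ S, z = D.cyc p ∨ z = D.cyc (p + 1)) {t : ℕ} (htm : t < m) (hk : 2 ≤ k)
    (ht : t < k ∨ m + 2 ≤ t + k) {x : V} (hx : D.root x = p + (t : ZMod m)) :
    D.height x ≠ 1 := by
  have h3 := D.three_le
  have : NeZero m := ⟨by omega⟩
  intro hx1
  have key : ∃ s < m, ∀ c : ℕ, c < 2 →
      1 + min (max t c - min t c) (m - (max t c - min t c)) =
        min (max s c - min s c) (m - (max s c - min s c)) := by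
    rcases Nat.eq_zero_or_pos t with rfl | h0
    · refine ⟨m - 1, by omega, fun c hc => ?_⟩
      interval_cases c <;> omega
    · rcases ht with ht | ht
      · refine ⟨t + 1, by omega, fun c hc => ?_⟩
        interval_cases c <;> omega
      · refine ⟨t - 1, by omega, fun c hc => ?_⟩
        interval_cases c <;> omega
  obtain ⟨s, hs, h⟩ := key
  obtain ⟨z, hz, hne⟩ := hS x (D.cyc (p + (s : ZMod m))) (fun e => by
    rw [e, D.height_cyc] at hx1; exact absurd hx1 (by norm_num))
  apply hne
  have hc : ∃ c : ℕ, c < 2 ∧ z = D.cyc (p + (c : ZMod m)) := by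
    rcases hSp z hz with e | e
    · exact ⟨0, by omega, by simpa using e⟩
    · exact ⟨1, by omega, by simpa using e⟩
  obtain ⟨c, hc, rfl⟩ := hc
  rw [D.dist_cyc hG, D.dist_cyc hG, hx, hx1, D.root_cyc, D.height_cyc,
    cycDist_add_natCast p htm (by omega), cycDist_add_natCast p hs (by omega), h c hc, zero_add]

/-- The analogue of `height_ne_one_of_isResolving_pair` for three consecutive vertices of a cycle
of length `2k`, with middle vertex `p`. -/
theorem height_ne_one_of_isResolving_triple (hG : G.Connected) {k : ℕ}
    (hm : m = 2 * k) (p : ZMod m) {S : Finset V} (hS : G.IsResolving S)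
    (hSp : ∀ z ∈ S, z = D.cyc p ∨ z = D.cyc (p + 1) ∨ z = D.cyc (p - 1)) {t : ℕ}
    (h1 : 1 ≤ t) (ht : t + 2 ≤ k) {x : V} (hx : D.root x = p + (t : ZMod m)) :
    D.height x ≠ 1 := by
  have h3 := D.three_le
  have : NeZero m := ⟨by omega⟩
  intro hx1
  obtain ⟨z, hz, hne⟩ := hS x (D.cyc (p + ((t + 1 : ℕ) : ZMod m))) (fun e => by
    rw [e, D.height_cyc] at hx1; exact absurd hx1 (by norm_num))
  apply hne
  have hc : ∃ c : ℕ, (c = 0 ∨ c = 1 ∨ c = m - 1) ∧ z = D.cyc (p + (c : ZMod m)) := by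
    rcases hSp z hz with e | e | e
    · exact ⟨0, by omega, by simpa using e⟩
    · exact ⟨1, by omega, by simpa using e⟩
    · refine ⟨m - 1, by omega, ?_⟩
      rw [e, Nat.cast_sub (by omega), ZMod.natCast_self]
      congr 1
      push_cast
      ring
  obtain ⟨c, hc, rfl⟩ := hc
  rw [D.dist_cyc hG, D.dist_cyc hG, hx, hx1, D.root_cyc, D.height_cyc,
    cycDist_add_natCast p (by omega) (by omega), cycDist_add_natCast p (by omega) (by omega)]
  rcases hc with rfl | rfl | rfl <;> omega

theorem adj_of_height_eq_zero {x y : V} (hx : D.height x = 0) (hy : D.height y = 0)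
    (h : G.Adj x y) : y = D.cyc (D.root x + 1) ∨ y = D.cyc (D.root x - 1) := by
  rcases D.adj_cases x y h with h' | h'
  · exact absurd h (by rw [← D.cyc_root x hx, ← D.cyc_root y hy, h'.1]; exact G.irrefl)
  · rcases h'.2.2 with e | e
    · exact Or.inl (by rw [← e, D.cyc_root y hy])
    · exact Or.inr (by rw [e, add_sub_cancel_right, D.cyc_root y hy])

end CyclicCoordinates

theorem exists_adj_of_mem [DecidableEq V] {S : Finset V}
    (hS : (G.induce (S : Set V)).Connected) (hcard : 2 ≤ S.card) {a : V} (ha : a ∈ S) :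
    ∃ b ∈ S, G.Adj a b := by
  obtain ⟨w, hw, hwa⟩ := Finset.exists_mem_ne hcard a
  obtain ⟨x, -, y, hy, hxy, rfl, -⟩ := exists_adj_of_induce_connected hS (fun x => x = a) ha hw
    rfl hwa
  exact ⟨y, hy, hxy⟩

/-- A connected graph on three vertices has a vertex adjacent to the other two. -/
theorem exists_center_of_card_eq_three [DecidableEq V] {S : Finset V}
    (hS : (G.induce (S : Set V)).Connected) (hcard : S.card = 3) :
    ∃ a b c, S = {a, b, c} ∧ G.Adj a b ∧ G.Adj a c ∧ b ≠ c := by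
  obtain ⟨a, b, c, hab, hac, hbc, rfl⟩ := Finset.card_eq_three.1 hcard
  obtain ⟨x, hx, hax⟩ := exists_adj_of_mem hS (by omega) (a := a) (by simp)
  obtain ⟨y, hy, hby⟩ := exists_adj_of_mem hS (by omega) (a := b) (by simp)
  obtain ⟨z, hz, hcz⟩ := exists_adj_of_mem hS (by omega) (a := c) (by simp)
  simp only [Finset.mem_insert, Finset.mem_singleton] at hx hy hz
  have hperm : ({a, b, c} : Finset V) = {b, a, c} := Finset.insert_comm _ _ _
  have hperm' : ({a, b, c} : Finset V) = {c, a, b} := by ext; simp; tauto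
  rcases hx with rfl | rfl | rfl
  · exact absurd hax G.irrefl
  · rcases hz with rfl | rfl | rfl
    · exact ⟨_, _, _, rfl, hax, hcz.symm, hbc⟩
    · exact ⟨_, _, _, hperm, hax.symm, hcz.symm, hac⟩
    · exact absurd hcz G.irrefl
  · rcases hy with rfl | rfl | rfl
    · exact ⟨_, _, _, rfl, hby.symm, hax, hbc⟩
    · exact absurd hby G.irrefl
    · exact ⟨_, _, _, hperm', hax.symm, hby.symm, hab⟩

namespace CyclicCoordinates

variable {m : ℕ} (D : G.CyclicCoordinates m)

/-! ### Recognizing suns and degrees -/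

/-- The neighbours of the cycle vertex `i` off the cycle are the vertices of height one attached
at `i`. -/
theorem degree_cyc_eq_two_iff [Fintype V] [DecidableRel G.Adj] (i : ZMod m) :
    G.degree (D.cyc i) = 2 ↔ ∀ x, D.root x = i → D.height x ≠ 1 := by
  classical
  have h1 : G.Adj (D.cyc i) (D.cyc (i + 1)) := D.adj_cyc i
  have h2 : G.Adj (D.cyc i) (D.cyc (i - 1)) := by
    have := D.adj_cyc (i - 1)
    rw [sub_add_cancel] at this
    exact this.symm
  have hne : D.cyc (i + 1) ≠ D.cyc (i - 1) :=
    fun e => ZMod.add_one_ne_sub_one D.three_le i (D.cyc_injective e)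
  rw [← card_neighborFinset_eq_degree]
  constructor
  · intro h x hx hx1
    obtain ⟨y, hxy, hyr, hyh⟩ := D.descend x (by omega)
    have hy : y = D.cyc i := by rw [← hx, ← hyr, D.cyc_root y (by omega)]
    have hsub : {x, D.cyc (i + 1), D.cyc (i - 1)} ⊆ G.neighborFinset (D.cyc i) := by
      intro z hz
      simp only [Finset.mem_insert, Finset.mem_singleton] at hz
      rw [mem_neighborFinset]
      rcases hz with rfl | rfl | rfl
      · exact hy ▸ hxy.symm
      · exact h1
      · exact h2
    have h0 : ∀ j, x ≠ D.cyc j := fun j e => by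
      rw [e, D.height_cyc] at hx1; exact absurd hx1 (by norm_num)
    have := Finset.card_le_card hsub
    rw [Finset.card_insert_of_notMem (by simp [h0]), Finset.card_pair hne, h] at this
    omega
  · intro h
    have : G.neighborFinset (D.cyc i) = {D.cyc (i + 1), D.cyc (i - 1)} := by
      ext z
      simp only [mem_neighborFinset, Finset.mem_insert, Finset.mem_singleton]
      constructor
      · intro hz
        have hz0 : D.height z = 0 := by
          rcases D.adj_cases _ _ hz.symm with e | e
          · rw [D.height_cyc, D.root_cyc] at e
            have := h z e.1
            omega
          · exact e.1
        have := D.adj_of_height_eq_zero (D.height_cyc i) hz0 hz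
        rwa [D.root_cyc] at this
      · rintro (rfl | rfl)
        · exact h1
        · exact h2
    rw [this, Finset.card_pair hne]

theorem _root_.sunGraph_adj {ℓ : ZMod m → ℕ} (p q : {p : ZMod m × ℕ // p.2 ≤ ℓ p.1}) :
    (sunGraph m ℓ).Adj p q ↔ p ≠ q ∧
      (((p.1.2 = 0 ∧ q.1.2 = 0 ∧ q.1.1 = p.1.1 + 1) ∨ (q.1.1 = p.1.1 ∧ q.1.2 = p.1.2 + 1)) ∨
      ((q.1.2 = 0 ∧ p.1.2 = 0 ∧ p.1.1 = q.1.1 + 1) ∨ (p.1.1 = q.1.1 ∧ p.1.2 = q.1.2 + 1))) :=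
  fromRel_adj _ _ _

variable {D}

/-- A graph with sun coordinates is a sun: the path at `i` has as many vertices as the greatest
height over `i`. -/
theorem IsSun.exists_iso [Finite V] (hD : D.IsSun) :
    ∃ (ℓ : ZMod m → ℕ) (φ : sunGraph m ℓ ≃g G), ∀ i, φ (sunCycleVertex m ℓ i) = D.cyc i := by
  choose leaf hleaf hmax using D.exists_leaf
  let f : V → {p : ZMod m × ℕ // p.2 ≤ D.height (leaf p.1)} :=
    fun x => ⟨(D.root x, D.height x), hmax _ x rfl⟩
  have hf : Function.Bijective f := by
    constructor
    · intro x y h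
      have h' := congrArg Subtype.val h
      exact hD x y (congrArg Prod.fst h') (congrArg Prod.snd h')
    · rintro ⟨⟨i, a⟩, ha⟩
      obtain ⟨y, hy, hya⟩ := D.exists_height_eq (leaf i) ha
      exact ⟨y, Subtype.ext (Prod.ext (hy.trans (hleaf i)) hya)⟩
  have hup : ∀ x y, D.root y = D.root x → D.height y = D.height x + 1 → G.Adj x y := by
    intro x y hr hh
    obtain ⟨z, hyz, hzr, hzh⟩ := D.descend y (by omega)
    rw [← hD z x (hzr.trans hr) (by omega)]
    exact hyz.symm
  have hcyc : ∀ x y, D.height x = 0 → D.height y = 0 → D.root y = D.root x + 1 →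
      G.Adj x y := by
    intro x y hx hy h
    rw [← D.cyc_root x hx, ← D.cyc_root y hy, h]
    exact D.adj_cyc _
  let e : G ≃g sunGraph m (fun i => D.height (leaf i)) :=
    { Equiv.ofBijective f hf with
      map_rel_iff' := by
        intro x y
        change (sunGraph m fun i => D.height (leaf i)).Adj (f x) (f y) ↔ _
        rw [sunGraph_adj]
        constructor
        · rintro ⟨-, (h | h) | (h | h)⟩
          · exact hcyc x y h.1 h.2.1 h.2.2
          · exact hup x y h.1 h.2
          · exact (hcyc y x h.1 h.2.1 h.2.2).symm
          · exact (hup y x h.1 h.2).symm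
        · intro h
          refine ⟨hf.1.ne h.ne, ?_⟩
          rcases D.adj_cases x y h with h' | h'
          · have h2 := D.height_le y x h.symm
            have h3 : D.height x ≠ D.height y := fun e => h.ne (hD x y h'.1 e)
            rcases lt_or_gt_of_ne h3 with h4 | h4
            · exact Or.inl (Or.inr ⟨h'.1.symm, show D.height y = D.height x + 1 by omega⟩)
            · exact Or.inr (Or.inr ⟨h'.1, show D.height x = D.height y + 1 by omega⟩)
          · rcases h'.2.2 with h2 | h2
            · exact Or.inl (Or.inl ⟨h'.1, h'.2.1, h2⟩)
            · exact Or.inr (Or.inl ⟨h'.2.1, h'.1, h2⟩) }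
  refine ⟨_, e.symm, fun i => ?_⟩
  rw [RelIso.symm_apply_eq]
  exact Subtype.ext (Prod.ext (D.root_cyc i).symm (D.height_cyc i).symm)

/-- The coordinates of a sun. -/
def ofSunGraphIso {ℓ : ZMod m → ℕ} (hm : 3 ≤ m) (φ : sunGraph m ℓ ≃g G) :
    G.CyclicCoordinates m where
  three_le := hm
  root x := (φ.symm x).1.1
  height x := (φ.symm x).1.2
  cyc i := φ (sunCycleVertex m ℓ i)
  root_cyc i := by rw [RelIso.symm_apply_apply]; rfl
  height_cyc i := by rw [RelIso.symm_apply_apply]; rfl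
  cyc_root x hx := by
    rw [← RelIso.eq_symm_apply]
    exact Subtype.ext (Prod.ext rfl hx.symm)
  adj_cyc i := by
    rw [φ.map_adj_iff, sunGraph_adj]
    refine ⟨fun h => ?_, Or.inl (Or.inl ⟨rfl, rfl, rfl⟩)⟩
    have h1 : i = i + 1 := congrArg (fun p => p.1.1) h
    have h2 := (cycDist_add_one_self hm i).1
    rw [← h1, cycDist_self] at h2
    exact absurd h2 (by norm_num)
  adj_cases x y h := by
    rw [← φ.symm.map_adj_iff, sunGraph_adj] at h
    rcases h with ⟨-, (h | h) | (h | h)⟩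
    · exact Or.inr ⟨h.1, h.2.1, Or.inl h.2.2⟩
    · exact Or.inl ⟨h.1.symm, by omega⟩
    · exact Or.inr ⟨h.2.1, h.1, Or.inr h.2.2⟩
    · exact Or.inl ⟨h.1, by omega⟩
  descend x hx := by
    have hle := (φ.symm x).2
    refine ⟨φ ⟨((φ.symm x).1.1, (φ.symm x).1.2 - 1), by dsimp only; omega⟩, ?_, ?_, ?_⟩
    · rw [← φ.symm.map_adj_iff, RelIso.symm_apply_apply, sunGraph_adj]
      refine ⟨fun h => ?_, Or.inr (Or.inr ⟨rfl, ?_⟩)⟩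
      · have := congrArg (fun p => p.1.2) h
        dsimp only at this
        omega
      · dsimp only; omega
    · rw [RelIso.symm_apply_apply]
    · rw [RelIso.symm_apply_apply]
      dsimp only; omega

theorem isSun_ofSunGraphIso {ℓ : ZMod m → ℕ} (hm : 3 ≤ m) (φ : sunGraph m ℓ ≃g G) :
    (ofSunGraphIso hm φ).IsSun := fun _ _ hr hh =>
  φ.symm.injective (Subtype.ext (Prod.ext hr hh))

end CyclicCoordinates

/-! ### Unicyclic graphs -/

/-- Every edge of a unicyclic graph off its cycle is a bridge. -/
theorem IsUnicyclic.isBridge (hG : G.IsUnicyclic) {v : V} {c : G.Walk v v} (hc : c.IsCycle)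
    {x y : V} (hxy : G.Adj x y) (h : s(x, y) ∉ c.edges) : G.IsBridge s(x, y) := by
  rw [isBridge_iff_forall_cycle_notMem (G.mem_edgeSet.2 hxy)]
  intro u p hp hmem
  have : p.toSubgraph = c.toSubgraph := hG.2.unique ⟨u, p, hp, rfl⟩ ⟨v, c, hc, rfl⟩
  rw [← Walk.mem_edges_toSubgraph, this, Walk.mem_edges_toSubgraph] at hmem
  exact h hmem

/-- Deleting the edges of the cycle of a unicyclic graph disconnects the cycle vertices from each
other: otherwise the first edge of a path between two of them would not be a bridge. -/
theorem IsUnicyclic.eq_of_reachable_deleteEdges (hG : G.IsUnicyclic) {v : V} {c : G.Walk v v}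
    (hc : c.IsCycle) {a b : V} (ha : a ∈ c.support) (hb : b ∈ c.support)
    (h : (G.deleteEdges {e | e ∈ c.edges}).Reachable a b) : a = b := by
  classical
  by_contra hne
  obtain ⟨p, hp⟩ := h.exists_isPath
  cases p with
  | nil => exact hne rfl
  | @cons _ y _ hay p =>
    rw [deleteEdges_adj] at hay
    have hbr := hG.isBridge hc hay.1 hay.2
    rw [isBridge_iff] at hbr
    apply hbr
    have hle : (G.deleteEdges {e | e ∈ c.edges}) ≤ G := deleteEdges_le _
    have hq : s(a, y) ∉ (p.mapLe hle).edges := fun hmem => by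
      have := Walk.fst_mem_support_of_mem_edges _ hmem
      rw [Walk.support_mapLe_eq_support] at this
      exact ((Walk.cons_isPath_iff _ _).1 hp).2 this
    have hyb : (G.deleteEdges {s(a, y)}).Reachable y b :=
      reachable_deleteEdges_iff_exists_walk.2 ⟨_, hq⟩
    have hcyc : ∀ u ∈ c.support, (G.deleteEdges {s(a, y)}).Reachable v u := fun u hu =>
      reachable_deleteEdges_iff_exists_walk.2
        ⟨c.takeUntil u hu, fun h => hay.2 (c.edges_takeUntil_subset_edges hu h)⟩
    exact ((hcyc a ha).symm.trans (hcyc b hb)).trans hyb.symm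

theorem Reachable.exists_adj_dist_add_one_eq {x z : V} (h : G.Reachable x z) (hne : x ≠ z) :
    ∃ y, G.Adj x y ∧ G.dist y z + 1 = G.dist x z := by
  obtain ⟨w, hw⟩ := h.exists_walk_length_eq_dist
  cases w with
  | nil => exact absurd rfl hne
  | @cons _ y _ hxy p =>
    rw [Walk.length_cons] at hw
    have h1 := dist_le p
    obtain ⟨q, hq⟩ := p.reachable.exists_walk_length_eq_dist
    have h2 := dist_le (q.cons hxy)
    rw [Walk.length_cons] at h2
    exact ⟨y, hxy, by omega⟩

/-- The trees of a unicyclic graph are the components left after deleting the edges of its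
cycle. -/
theorem IsUnicyclic.nonempty_cyclicCoordinates (hG : G.IsUnicyclic) {v : V} {c : G.Walk v v}
    (hc : c.IsCycle) : Nonempty (G.CyclicCoordinates c.length) := by
  classical
  have h3 := hc.three_le_length
  set m := c.length with hm
  have : NeZero m := ⟨by omega⟩
  set H := G.deleteEdges {e | e ∈ c.edges} with hH
  let cyc : ZMod m → V := fun i => c.getVert i.val
  have hcast : ∀ n : ℕ, n ≤ m → c.getVert n = cyc (n : ZMod m) := by
    intro n hn
    rcases hn.lt_or_eq with h | rfl
    · simp only [cyc, ZMod.val_natCast_of_lt h]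
    · simp [cyc, hm]
  have hsupp : ∀ i, cyc i ∈ c.support := fun i => c.getVert_mem_support _
  have hinj : Function.Injective cyc := fun i j h => by
    have hi := ZMod.val_lt i
    have hj := ZMod.val_lt j
    exact ZMod.val_injective m (hc.getVert_injOn' (by simp; omega) (by simp; omega) h)
  have hedge : ∀ x y, s(x, y) ∈ c.edges ↔
      ∃ i, (x = cyc i ∧ y = cyc (i + 1)) ∨ (y = cyc i ∧ x = cyc (i + 1)) := by
    intro x y
    rw [← Walk.adj_toSubgraph_iff_mem_edges, Walk.toSubgraph_adj_iff]
    constructor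
    · rintro ⟨n, h, hn⟩
      refine ⟨(n : ZMod m), ?_⟩
      rw [hcast n hn.le, hcast (n + 1) hn, Nat.cast_succ, Sym2.eq_iff] at h
      rcases h with ⟨rfl, rfl⟩ | ⟨rfl, rfl⟩
      · exact Or.inl ⟨rfl, rfl⟩
      · exact Or.inr ⟨rfl, rfl⟩
    · rintro ⟨i, h⟩
      have hi := ZMod.val_lt i
      refine ⟨i.val, ?_, hi⟩
      rw [hcast _ hi.le, hcast _ hi, Nat.cast_succ, ZMod.natCast_zmod_val, Sym2.eq_iff]
      rcases h with ⟨rfl, rfl⟩ | ⟨rfl, rfl⟩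
      · exact Or.inl ⟨rfl, rfl⟩
      · exact Or.inr ⟨rfl, rfl⟩
  have hroot : ∀ x, ∃ i, H.Reachable x (cyc i) := by
    have hstep : ∀ a b, G.Adj a b → (∃ i, H.Reachable b (cyc i)) → ∃ i, H.Reachable a (cyc i) := by
      rintro a b hab ⟨i, hi⟩
      by_cases he : s(a, b) ∈ c.edges
      · obtain ⟨j, h | h⟩ := (hedge a b).1 he
        · exact ⟨j, h.1 ▸ Reachable.refl _⟩
        · exact ⟨j + 1, h.2 ▸ Reachable.refl _⟩
      · have : H.Adj a b := by rw [hH, deleteEdges_adj]; exact ⟨hab, he⟩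
        exact ⟨i, this.reachable.trans hi⟩
    have hwalk : ∀ a b, G.Walk a b → (∃ i, H.Reachable b (cyc i)) →
        ∃ i, H.Reachable a (cyc i) := by
      intro a b w h
      induction w with
      | nil => exact h
      | cons hab _ ih => exact hstep _ _ hab (ih h)
    intro x
    obtain ⟨w⟩ := hG.1 x (cyc 0)
    exact hwalk _ _ w ⟨0, Reachable.refl _⟩
  choose root hroot using hroot
  have huniq : ∀ x i, H.Reachable x (cyc i) → root x = i := fun x i h =>
    hinj (hG.eq_of_reachable_deleteEdges hc (hsupp _) (hsupp _) ((hroot x).symm.trans h))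
  have hrc : ∀ i, root (cyc i) = i := fun i => huniq _ _ (Reachable.refl _)
  have hadj : ∀ x y, H.Adj x y → root x = root y := fun x y h =>
    huniq _ _ (h.reachable.trans (hroot y))
  refine ⟨{ three_le := h3, root := root, height := fun x => H.dist x (cyc (root x)), cyc := cyc,
            root_cyc := hrc, height_cyc := fun i => ?_, cyc_root := fun x hx => ?_,
            adj_cyc := fun i => ?_, adj_cases := fun x y h => ?_, descend := fun x hx => ?_ }⟩
  · simp [hrc]
  · exact ((hroot x).dist_eq_zero_iff.1 hx).symm
  · exact c.adj_of_mem_edges ((hedge _ _).2 ⟨i, Or.inl ⟨rfl, rfl⟩⟩)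
  · by_cases he : s(x, y) ∈ c.edges
    · right
      obtain ⟨j, ⟨rfl, rfl⟩ | ⟨rfl, rfl⟩⟩ := (hedge x y).1 he
      · simp [hrc]
      · simp [hrc]
    · left
      have h' : H.Adj x y := by rw [hH, deleteEdges_adj]; exact ⟨h, he⟩
      refine ⟨hadj x y h', ?_⟩
      rw [hadj x y h']
      obtain ⟨w, hw⟩ := (hroot y).exists_walk_length_eq_dist
      have := dist_le (w.cons h')
      rw [Walk.length_cons, hw] at this
      exact this
  · obtain ⟨y, hxy, hy⟩ := (hroot x).exists_adj_dist_add_one_eq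
      (fun e => hx (by rw [← e, dist_self]))
    refine ⟨y, (deleteEdges_le _) hxy, (hadj _ _ hxy).symm, ?_⟩
    rw [← hadj _ _ hxy]
    exact hy

/-! ### Comparing the two dimensions -/

namespace CyclicCoordinates

variable {m : ℕ}

/-- A sun resolved by two adjacent cycle vertices has the required run of vertices of degree
two. -/
theorem IsSun.isSunWithDegTwoRun [Fintype V] [DecidableRel G.Adj] {D : G.CyclicCoordinates m}
    (hD : D.IsSun) (hG : G.Connected) {k : ℕ} (hm : m = 2 * k ∨ m = 2 * k + 1) (p : ZMod m)
    {S : Finset V} (hS : G.IsResolving S) (hSp : ∀ z ∈ S, z = D.cyc p ∨ z = D.cyc (p + 1)) :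
    G.IsSunWithDegTwoRun m (2 * k - 2) := by
  obtain ⟨ℓ, φ, hφ⟩ := hD.exists_iso
  have h3 := D.three_le
  -- the run consists of `p + t` for `-k + 2 ≤ t ≤ k - 1`
  refine ⟨h3, ℓ, φ, p + 2 - k, fun j hj => ?_⟩
  rw [hφ, D.degree_cyc_eq_two_iff]
  intro x hx
  obtain ⟨t, htm, ht, e⟩ : ∃ t < m, (t < k ∨ m + 2 ≤ t + k) ∧
      p + 2 - k + (j : ZMod m) = p + (t : ZMod m) := by
    by_cases hjk : k ≤ j + 2
    · refine ⟨j + 2 - k, by omega, by omega, ?_⟩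
      rw [Nat.cast_sub hjk]
      push_cast
      ring
    · refine ⟨m + j + 2 - k, by omega, by omega, ?_⟩
      rw [Nat.cast_sub (by omega)]
      push_cast
      rw [ZMod.natCast_self]
      ring
  exact D.height_ne_one_of_isResolving_pair hG hm p hS hSp htm (by omega) ht (hx.trans e)

/-- Two adjacent cycle vertices form a resolving set of a sun with the required run of vertices of
degree two. -/
theorem connMetricDim_eq_metricDim_of_isSunWithDegTwoRun [Fintype V] [DecidableRel G.Adj]
    (hG : G.Connected) {k : ℕ} (hm : m = 2 * k ∨ m = 2 * k + 1)
    (h : G.IsSunWithDegTwoRun m (2 * k - 2)) : G.connMetricDim = G.metricDim := by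
  classical
  obtain ⟨h3, ℓ, φ, i, hdeg⟩ := h
  have : NeZero m := ⟨by omega⟩
  set D := ofSunGraphIso h3 φ with hDdef
  have hD : D.IsSun := isSun_ofSunGraphIso h3 φ
  set p : ZMod m := i + k - 2 with hp
  have hres : G.IsResolving {D.cyc p, D.cyc (p + 1)} := by
    refine hD.isResolving_pair hG hm p fun t htm hk ht x hx => ?_
    obtain ⟨j, hj, e⟩ : ∃ j < 2 * k - 2, p + (t : ZMod m) = i + (j : ZMod m) := by
      rcases ht with ht | ht
      · refine ⟨k + t - 2, by omega, ?_⟩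
        rw [Nat.cast_sub (by omega), hp]
        push_cast
        ring
      · refine ⟨k + t - 2 - m, by omega, ?_⟩
        rw [Nat.cast_sub (by omega), Nat.cast_sub (by omega), hp, ZMod.natCast_self]
        push_cast
        ring
    by_contra h0
    obtain ⟨y, hy, hy1⟩ := D.exists_height_eq x (n := 1) (by omega)
    exact (D.degree_cyc_eq_two_iff _).1 (hdeg j hj) y (hy.trans (hx.trans e)) hy1
  have hconn : (G.induce (({D.cyc p, D.cyc (p + 1)} : Finset V) : Set V)).Connected := by
    rw [Finset.coe_pair]
    exact induce_pair_connected_of_adj (D.adj_cyc p)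
  have h1 : G.connMetricDim ≤ 2 :=
    (IsConnectedResolving.connMetricDim_le ⟨hres, hconn⟩).trans Finset.card_le_two
  obtain ⟨S, hS, hcard⟩ := G.exists_isResolving_card_eq_metricDim hG
  have h2 := D.two_le_card hG hS
  have h3 := hG.metricDim_le_connMetricDim
  omega

/-- If a connected resolving set attains the metric dimension, the graph is a sun, and two
adjacent cycle vertices resolve it. -/
theorem isSun_and_exists_pair [Fintype V] (D : G.CyclicCoordinates m) (hG : G.Connected)
    (h : G.connMetricDim = G.metricDim) {k : ℕ} (hm : m = 2 * k ∨ m = 2 * k + 1) :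
    D.IsSun ∧ ∃ (p : ZMod m) (S : Finset V), G.IsResolving S ∧
      ∀ z ∈ S, z = D.cyc p ∨ z = D.cyc (p + 1) := by
  classical
  have h3 := D.three_le
  have : NeZero m := ⟨by omega⟩
  obtain ⟨S, hS, hcard⟩ := G.exists_isConnectedResolving_card_eq_connMetricDim hG
  rw [h] at hcard
  have h0 : ∀ u ∈ S, D.height u = 0 := fun u hu => D.height_eq_zero_of_mem hG hS hcard hu
  have hD : D.IsSun := D.ext_of_isResolving hG hS.1 h0
  refine ⟨hD, ?_⟩
  have h2 := D.two_le_card hG hS.1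
  have hcard2 : S.card = 2 := by
    rcases hm with hm | hm
    · have hle := hD.metricDim_le_three_of_even hG hm
      by_contra hne
      obtain ⟨a, b, c, rfl, hab, hac, hbc⟩ := exists_center_of_card_eq_three hS.2 (by omega)
      have ha := h0 a (by simp)
      have hb := D.adj_of_height_eq_zero ha (h0 b (by simp)) hab
      have hc := D.adj_of_height_eq_zero ha (h0 c (by simp)) hac
      have := hD.metricDim_le_two_of_even hG hm (D.root a) fun t h1 ht x hx =>
        D.height_ne_one_of_isResolving_triple hG hm (D.root a) hS.1 (fun z hz => by
          simp only [Finset.mem_insert, Finset.mem_singleton] at hz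
          rcases hz with rfl | rfl | rfl
          · exact Or.inl (D.cyc_root _ ha).symm
          · exact Or.inr hb
          · exact Or.inr hc) h1 ht hx
      omega
    · have := hD.metricDim_le_two_of_odd hG hm
      omega
  obtain ⟨a, ha⟩ := Finset.card_pos.1 (show 0 < S.card by omega)
  obtain ⟨b, hb, hab⟩ := exists_adj_of_mem hS.2 h2 ha
  have hSab : S = {a, b} := (Finset.eq_of_subset_of_card_le (by
    intro z hz
    simp only [Finset.mem_insert, Finset.mem_singleton] at hz
    rcases hz with rfl | rfl <;> assumption) (by rw [Finset.card_pair hab.ne, hcard2])).symm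
  have ha0 := h0 a ha
  rcases D.adj_of_height_eq_zero ha0 (h0 b hb) hab with e | e
  · refine ⟨D.root a, S, hS.1, fun z hz => ?_⟩
    rw [D.cyc_root a ha0, ← e]
    simpa [hSab] using hz
  · refine ⟨D.root a - 1, S, hS.1, fun z hz => ?_⟩
    rw [sub_add_cancel, D.cyc_root a ha0, ← e, or_comm]
    simpa [hSab] using hz

end CyclicCoordinates

end SimpleGraph

theorem mainTheorem5 {V : Type*} [Fintype V] (G : SimpleGraph V) [DecidableRel G.Adj]
    (hG : G.IsUnicyclic) {v : V} (c : G.Walk v v) (hc : c.IsCycle) :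
    (Odd c.length → (G.connMetricDim = G.metricDim ↔ G.MemU₁)) ∧
    (Even c.length → (G.connMetricDim = G.metricDim ↔ G.MemU₂)) := by
  obtain ⟨D⟩ := hG.nonempty_cyclicCoordinates hc
  have h3 := D.three_le
  refine ⟨fun ⟨k, hk⟩ => ⟨fun h => ?_, ?_⟩, fun ⟨k, hk⟩ => ⟨fun h => ?_, ?_⟩⟩
  · obtain ⟨hD, p, S, hS, hSp⟩ := D.isSun_and_exists_pair hG.1 h (Or.inr hk)
    exact ⟨k, by omega, hk ▸ hD.isSunWithDegTwoRun hG.1 (Or.inr hk) p hS hSp⟩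
  · rintro ⟨l, -, hl⟩
    exact SimpleGraph.CyclicCoordinates.connMetricDim_eq_metricDim_of_isSunWithDegTwoRun hG.1
      (Or.inr rfl) hl
  · have hk' : c.length = 2 * k := by omega
    obtain ⟨hD, p, S, hS, hSp⟩ := D.isSun_and_exists_pair hG.1 h (Or.inl hk')
    exact ⟨k, by omega, hk' ▸ hD.isSunWithDegTwoRun hG.1 (Or.inl hk') p hS hSp⟩
  · rintro ⟨l, -, hl⟩
    exact SimpleGraph.CyclicCoordinates.connMetricDim_eq_metricDim_of_isSunWithDegTwoRun hG.1
      (Or.inl rfl) hl
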